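/- Let $m\ge 1$ and $k\geq 3$ be integers with $\lfloor k/2\rfloor+1\le m$. Let $\mathbf{K}_{m,m}$ be the complete bipartite graph with disjoint parts $\mathcal R=\{R_1,\dots,R_m\}$ and $\mathcal C=\{C_1,\dots,C_m\}$, and let $\mathcal P=\mathcal R\times\mathcal C$. Let $K=\mathrm{Sym}(\mathcal R)\times\mathrm{Sym}(\mathcal C)$ act naturally by automorphisms of $\mathbf{K}_{m,m}$, let $\tau$ be the automorphism interchanging $R_i$ and $C_i$ for all $i$, and let $G=\langle K,\tau\rangle$. For a subgraph $\Delta$ of $\mathbf{K}_{m,m}$ let $B(\Delta)$ be the set of all $(R,C)\in\mathcal P$ such that $\{R,C\}$ is an edge of $\Delta$, and define the incidence structures $$\mathcal D(\Delta)=(\mathcal P,\{B(\Delta^g)\mid g\in K\}),\qquad \widehat{\mathcal D}(\Delta)=(\mathcal P,\{B(\Delta^g)\mid g\in G\}).$$ An incidence structure whose blocks are subsets of a finite point set is a $t$-$(v,k,\lambda)$ design ($t,v,k,\lambda$ positive integers) if it has $v$ points, each block has size $k$, and each $t$-element set of points is contained in exactly $\lambda$ blocks; it is a $t$-design if it is a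 $t$-$(v,k,\lambda)$ design for some $v,k,\lambda$. Let $\Delta=P_k$ be the $k$-path in $\mathbf{K}_{m,m}$ with edges $\{R_i,C_i\}$ for $1\le i\le\lceil k/2\rceil$ and $\{R_{i+1},C_i\}$ for $1\le i\le\lfloor k/2\rfloor$. Then $\widehat{\mathcal D}(\Delta)$ is not a $3$-design unless $(k,m)=(3,2)$, and $\widehat{\mathcal D}(\Delta)$ is a $2$-design if and only if $m=k-1$. Moreover, if $m=k-1$, then: (a) if $k$ is odd, then (i) $\widehat{\mathcal D}(\Delta)=\mathcal D(\Delta)$, and hence $\mathcal D(\Delta)$ is a $2$-design, and (ii) $\widehat{\mathcal D}(\Delta)$ is a $2$-$((k-1)^2,k,\lambda)$ design with $$\lambda=\frac{(k-1)!\,(k-3)!}{\left(\left(\frac{k-3}{2}\right)!\right)^2};$$ (b) if $k$ is even, then (i) $\widehat{\mathcal D}(\Delta)\ne\mathcal D(\Delta)$ and $\mathcal D(\Delta)$ is not a $2$-design, and (ii) $\widehat{\mathcal D}(\Delta)$ is a $2$-$((k-1)^2,k,\lambda)$ design with $$\lambda=\frac{(k-1)!\,(k-3)!}{\left(\frac k2-2\right)!\,\left(\frac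 k2-1\right)!}.$$ -/

import Mathlib

/-- A point-block incidence structure on the point set `P`: the blocks are subsets of `P`,
incidence is membership. -/
@[ext]
structure IncidenceStructure (P : Type*) where
  blocks : Set (Set P)

namespace IncidenceStructure

/-- `D` is a `t`-`(v, k, l)` design (`t, v, k, l` positive): there are `v` points, each block has
size `k`, and each `t`-element set of points is contained in exactly `l` blocks. -/
structure IsDesign {P : Type*} [Finite P] (D : IncidenceStructure P) (t v k l : ℕ) : Prop where
  t_pos : 0 < t
  v_pos : 0 < v
  k_pos : 0 < k
  l_pos : 0 < l
  card_points : Nat.card P = v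
  card_block : ∀ B ∈ D.blocks, B.ncard = k
  card_blocks_through : ∀ T : Set P, T.ncard = t → {B | B ∈ D.blocks ∧ T ⊆ B}.ncard = l

/-- `D` is a `t`-design: a `t`-`(v, k, l)` design for some `v, k, l`. -/
def IsTDesign {P : Type*} [Finite P] (D : IncidenceStructure P) (t : ℕ) : Prop :=
  ∃ v k l : ℕ, D.IsDesign t v k l

end IncidenceStructure

namespace GridDesign

/-- The complete bipartite graph `K_{m,n}`; `Sum.inl i` is the vertex `R_{i+1}` and `Sum.inr j`
is the vertex `C_{j+1}`. -/
abbrev Kmn (m n : ℕ) : SimpleGraph (Fin m ⊕ Fin n) := completeBipartiteGraph (Fin m) (Fin n)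

/-- The point set of the grid: the pairs `(R_i, C_j)`. -/
abbrev Point (m n : ℕ) : Type := Fin m × Fin n

/-- The block `B(Δ)`: all points `(R, C)` such that `{R, C}` is an edge of `Δ`. -/
def block {m n : ℕ} (Δ : (Kmn m n).Subgraph) : Set (Point m n) :=
  {p | Δ.Adj (Sum.inl p.1) (Sum.inr p.2)}

/-- The automorphism of `K_{m,n}` given by a permutation of each of the two parts. -/
def partAut (m n : ℕ) :
    Equiv.Perm (Fin m) × Equiv.Perm (Fin n) →* (Kmn m n ≃g Kmn m n) where
  toFun s :=
    { toEquiv := Equiv.sumCongr s.1 s.2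
      map_rel_iff' := by rintro (a | a) (b | b) <;> simp }
  map_one' := by ext (a | a) <;> rfl
  map_mul' s t := by ext (a | a) <;> rfl

/-- `K = Sym(R) × Sym(C)`, as a group of automorphisms of `K_{m,n}`. -/
def groupK (m n : ℕ) : Subgroup (Kmn m n ≃g Kmn m n) := (partAut m n).range

/-- The automorphism `τ` of `K_{m,m}` interchanging `R_i` and `C_i` for all `i`. -/
def tau (m : ℕ) : Kmn m m ≃g Kmn m m where
  toEquiv := Equiv.sumComm (Fin m) (Fin m)
  map_rel_iff' := by rintro (a | a) (b | b) <;> simp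

/-- `G = ⟨K, τ⟩`. -/
def groupG (m : ℕ) : Subgroup (Kmn m m ≃g Kmn m m) :=
  Subgroup.closure ((groupK m m : Set (Kmn m m ≃g Kmn m m)) ∪ {tau m})

/-- `Δ^g`, the image of the subgraph `Δ` under the automorphism `g`. -/
def image {m n : ℕ} (Δ : (Kmn m n).Subgraph) (g : Kmn m n ≃g Kmn m n) : (Kmn m n).Subgraph :=
  Δ.map g.toHom

/-- The incidence structure `D(Δ)`, with blocks `B(Δ^g)` for `g ∈ K`. -/
def design {m n : ℕ} (Δ : (Kmn m n).Subgraph) : IncidenceStructure (Point m n) where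
  blocks := {B | ∃ g ∈ groupK m n, B = block (image Δ g)}

/-- The incidence structure `D̂(Δ)`, with blocks `B(Δ^g)` for `g ∈ G`. -/
def designHat {m : ℕ} (Δ : (Kmn m m).Subgraph) : IncidenceStructure (Point m m) where
  blocks := {B | ∃ g ∈ groupG m, B = block (image Δ g)}

/-- The subgraph of `K_{m,n}` with edges `{R, C}` for `(R, C) ∈ S`, and no isolated vertices. -/
def ofPairs {m n : ℕ} (S : Set (Point m n)) : (Kmn m n).Subgraph where
  verts := {v | ∃ p ∈ S, v = Sum.inl p.1 ∨ v = Sum.inr p.2}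
  Adj u v := ∃ p ∈ S, (u = Sum.inl p.1 ∧ v = Sum.inr p.2) ∨ (u = Sum.inr p.2 ∧ v = Sum.inl p.1)
  adj_sub := by
    rintro u v ⟨p, -, ⟨rfl, rfl⟩ | ⟨rfl, rfl⟩⟩ <;> simp
  edge_vert := by
    rintro u v ⟨p, hp, ⟨rfl, -⟩ | ⟨rfl, -⟩⟩
    · exact ⟨p, hp, Or.inl rfl⟩
    · exact ⟨p, hp, Or.inr rfl⟩
  symm := by
    constructor
    rintro u v ⟨p, hp, h | h⟩
    · exact ⟨p, hp, Or.inr ⟨h.2, h.1⟩⟩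
    · exact ⟨p, hp, Or.inl ⟨h.2, h.1⟩⟩

/-- The `k`-path `P_k` in `K_{m,m}`, with edges `{R_i, C_i}` for `1 ≤ i ≤ ⌈k/2⌉` and
`{R_{i+1}, C_i}` for `1 ≤ i ≤ ⌊k/2⌋` (indices are shifted to start from `0`). It is a path with
`k` edges when it fits into `K_{m,m}`, that is, when `⌊k/2⌋ + 1 ≤ m`. -/
def path (m k : ℕ) : (Kmn m m).Subgraph :=
  ofPairs {p | ((p.1 : ℕ) = p.2 ∧ (p.2 : ℕ) < (k + 1) / 2) ∨
    ((p.1 : ℕ) = p.2 + 1 ∧ (p.2 : ℕ) < k / 2)}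

end GridDesign

/-!
The points of the grid are the edges of `K_{m,m}`, so `G`, which is the full automorphism group of
`K_{m,m}`, acts on them, and `D̂(Δ)` has a single orbit of blocks. Such a structure is a `t`-design
exactly when the base block contains the right proportion of each `G`-orbit of `t`-sets of points.
There are two orbits of pairs, the collinear and the non-collinear ones, and a path contains `k - 1`
collinear pairs, so the criterion for `t = 2` reads `k (k - 1) = (m + 1) (k - 1)`. For `t = 3` and
`m ≥ 3` a triple on one line lies in no block. The subgroup `K` keeps rows and columns apart, so a
`2`-design `D(Δ)` would need equally many collinear pairs of both kinds, which is impossible if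
`k - 1` is odd. Finally, the stabilizer of a path in `G` consists of the pointwise stabilizer of its
vertices and one further coset, that of a reversal; the reversal lies outside `K` exactly when `k`
is odd, and counting the cosets gives the number of blocks and hence `λ`.
-/

namespace IncidenceStructure

open MulAction
open scoped Pointwise

section DoubleCounting

variable {P : Type*} [Finite P] {D : IncidenceStructure P}

theorem ncard_mul_eq_ncard_blocks_mul {𝒯 : Set (Set P)} {l n : ℕ}
    (hl : ∀ T ∈ 𝒯, {B | B ∈ D.blocks ∧ T ⊆ B}.ncard = l)
    (hn : ∀ B ∈ D.blocks, {T | T ∈ 𝒯 ∧ T ⊆ B}.ncard = n) :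
    𝒯.ncard * l = D.blocks.ncard * n := by
  classical
  have := Fintype.ofFinite P
  rw [Set.ncard_eq_toFinset_card', Set.ncard_eq_toFinset_card']
  refine Finset.card_mul_eq_card_mul (· ⊆ ·) (fun T hT ↦ ?_) (fun B hB ↦ ?_)
  · rw [← hl T (Set.mem_toFinset.1 hT), Set.ncard_eq_toFinset_card']
    congr 1
    ext B
    simp [Finset.mem_bipartiteAbove]
  · rw [← hn B (Set.mem_toFinset.1 hB), Set.ncard_eq_toFinset_card']
    congr 1
    ext T
    simp [Finset.mem_bipartiteBelow]

theorem IsDesign.choose_mul_eq {t v k l : ℕ} (hD : D.IsDesign t v k l) :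
    v.choose t * l = D.blocks.ncard * k.choose t := by
  rw [← hD.card_points, ← Set.ncard_univ, ← Set.ncard_powerset_ncard Set.finite_univ]
  refine ncard_mul_eq_ncard_blocks_mul (fun T hT ↦ hD.card_blocks_through T hT.2) fun B hB ↦ ?_
  rw [← hD.card_block B hB, ← Set.ncard_powerset_ncard B.toFinite]
  congr 1
  ext T
  simp [and_comm]

theorem IsDesign.exists_block_superset {t v k l : ℕ} (hD : D.IsDesign t v k l) {T : Set P}
    (hT : T.ncard = t) : ∃ B ∈ D.blocks, T ⊆ B :=
  Set.nonempty_of_ncard_ne_zero ((hD.card_blocks_through T hT).trans_ne hD.l_pos.ne')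

theorem IsTDesign.exists_isDesign {t : ℕ} (hD : D.IsTDesign t) {B : Set P} (hB : B ∈ D.blocks) :
    ∃ l, D.IsDesign t (Nat.card P) B.ncard l := by
  obtain ⟨v, k, l, h⟩ := hD
  exact ⟨l, by rwa [h.card_points, h.card_block B hB]⟩

end DoubleCounting

section Orbit

variable {P : Type*} (H : Type*) [Group H] [MulAction H P]

/-- The incidence structure whose blocks are the images of the base block `B` under `H`. -/
def ofOrbit (B : Set P) : IncidenceStructure P :=
  ⟨orbit H B⟩

variable {H} {B T : Set P} {𝒯 : Set (Set P)}

theorem ncard_blocks_superset_smul (h : H) (T : Set P) :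
    {B' | B' ∈ (ofOrbit H B).blocks ∧ h • T ⊆ B'}.ncard =
      {B' | B' ∈ (ofOrbit H B).blocks ∧ T ⊆ B'}.ncard := by
  rw [← Set.ncard_smul_set h {B' | B' ∈ (ofOrbit H B).blocks ∧ T ⊆ B'}]
  congr 1
  ext B'
  have hB' : h⁻¹ • B' ∈ orbit H B ↔ B' ∈ orbit H B := by
    rw [← orbit_eq_iff, orbit_smul, orbit_eq_iff]
  simp [ofOrbit, hB', Set.mem_smul_set_iff_inv_smul_mem, Set.subset_smul_set_iff]

theorem ncard_subset_smul (h𝒯 : ∀ h : H, ∀ T ∈ 𝒯, h • T ∈ 𝒯) (h : H) (B : Set P) :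
    {T | T ∈ 𝒯 ∧ T ⊆ h • B}.ncard = {T | T ∈ 𝒯 ∧ T ⊆ B}.ncard := by
  rw [← Set.ncard_smul_set h {T | T ∈ 𝒯 ∧ T ⊆ B}]
  congr 1
  ext T
  have hT : h⁻¹ • T ∈ 𝒯 ↔ T ∈ 𝒯 := ⟨fun hT ↦ by simpa using h𝒯 h _ hT, h𝒯 h⁻¹ T⟩
  simp [Set.mem_smul_set_iff_inv_smul_mem, hT, Set.subset_smul_set_iff]

theorem ncard_orbit_pos [Finite P] : 0 < (orbit H T).ncard :=
  (Set.ncard_pos).2 (nonempty_orbit T)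

variable [Finite P]

theorem IsDesign.ncard_invariant_mul_eq {t v k l : ℕ} (hD : (ofOrbit H B).IsDesign t v k l)
    (h𝒯 : ∀ h : H, ∀ T ∈ 𝒯, h • T ∈ 𝒯) (ht : ∀ T ∈ 𝒯, T.ncard = t) :
    𝒯.ncard * l = (ofOrbit H B).blocks.ncard * {T | T ∈ 𝒯 ∧ T ⊆ B}.ncard := by
  refine ncard_mul_eq_ncard_blocks_mul (fun T hT ↦ hD.card_blocks_through T (ht T hT)) ?_
  rintro _ ⟨h, rfl⟩
  exact ncard_subset_smul h𝒯 h B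

theorem ncard_orbit_mul_ncard_blocks_superset (B T : Set P) :
    (orbit H T).ncard * {B' | B' ∈ (ofOrbit H B).blocks ∧ T ⊆ B'}.ncard =
      (ofOrbit H B).blocks.ncard * {T' | T' ∈ orbit H T ∧ T' ⊆ B}.ncard := by
  refine ncard_mul_eq_ncard_blocks_mul ?_ ?_
  · rintro _ ⟨h, rfl⟩
    exact ncard_blocks_superset_smul h T
  · rintro _ ⟨h, rfl⟩
    exact ncard_subset_smul (fun h _ ↦ mem_orbit_of_mem_orbit h) h B

theorem ofOrbit_isTDesign_iff {t : ℕ} (ht : 0 < t) (htB : t ≤ B.ncard) :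
    (ofOrbit H B).IsTDesign t ↔ ∀ T : Set P, T.ncard = t →
      (orbit H T).ncard * B.ncard.choose t =
        (Nat.card P).choose t * {T' | T' ∈ orbit H T ∧ T' ⊆ B}.ncard := by
  set b := (ofOrbit H B).blocks.ncard
  have hb_pos : 0 < b := ncard_orbit_pos
  have hk_pos : 0 < B.ncard.choose t := Nat.choose_pos htB
  have hv_pos : 0 < (Nat.card P).choose t := Nat.choose_pos (htB.trans (Set.ncard_le_card B))
  constructor
  · intro hD T hT
    obtain ⟨l, hl⟩ := hD.exists_isDesign (mem_orbit_self (M := H) B)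
    have h_all := hl.choose_mul_eq
    have h_orbit := ncard_orbit_mul_ncard_blocks_superset (H := H) B T
    rw [hl.card_blocks_through T hT] at h_orbit
    refine Nat.eq_of_mul_eq_mul_left hb_pos ?_
    linear_combination (orbit H T).ncard * h_all.symm + (Nat.card P).choose t * h_orbit
  · intro h
    have h_through (T : Set P) (hT : T.ncard = t) :
        {B' | B' ∈ (ofOrbit H B).blocks ∧ T ⊆ B'}.ncard * (Nat.card P).choose t =
          b * B.ncard.choose t := by
      refine Nat.eq_of_mul_eq_mul_left (ncard_orbit_pos (H := H) (T := T)) ?_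
      have h_orbit := ncard_orbit_mul_ncard_blocks_superset (H := H) B T
      linear_combination (Nat.card P).choose t * h_orbit + b * (h T hT).symm
    obtain ⟨T₀, -, hT₀⟩ := Set.exists_subset_card_eq htB
    refine ⟨_, B.ncard, _, ht, ?_, ht.trans_le htB, ?_, rfl, ?_, fun T hT ↦
      Nat.eq_of_mul_eq_mul_right hv_pos ((h_through T hT).trans (h_through T₀ hT₀).symm)⟩
    · exact (ht.trans_le htB).trans_le (Set.ncard_le_card B)
    · exact Nat.pos_of_mul_pos_right (h_through T₀ hT₀ ▸ Nat.mul_pos hb_pos hk_pos)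
    · rintro _ ⟨h, rfl⟩
      exact Set.ncard_smul_set h B

end Orbit

end IncidenceStructure

namespace GridDesign

open Equiv MulAction IncidenceStructure
open scoped Pointwise

section Action

variable {m n : ℕ}

/-- The edge `{R, C}` of `K_{m,n}` named by the point `(R, C)` of the grid. -/
def edge (p : Point m n) : Sym2 (Fin m ⊕ Fin n) :=
  s(Sum.inl p.1, Sum.inr p.2)

theorem edge_injective : Function.Injective (edge : Point m n → _) := by
  rintro ⟨i, j⟩ ⟨i', j'⟩ h
  simpa [edge] using h

theorem range_edge : Set.range (edge : Point m n → _) = (Kmn m n).edgeSet :=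
  SimpleGraph.edgeSet_completeBipartiteGraph.symm

/-- An automorphism of `K_{m,n}` moves a grid point by moving the edge that the point names. -/
noncomputable instance : SMul (Kmn m n ≃g Kmn m n) (Point m n) where
  smul g p :=
    let e := (ofInjective edge edge_injective).trans (setCongr range_edge)
    e.symm (g.mapEdgeSet (e p))

theorem edge_smul (g : Kmn m n ≃g Kmn m n) (p : Point m n) : edge (g • p) = (edge p).map g :=
  congrArg Subtype.val
    (((ofInjective edge edge_injective).trans (setCongr range_edge)).apply_symm_apply _)

noncomputable instance : MulAction (Kmn m n ≃g Kmn m n) (Point m n) where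
  one_smul p := edge_injective ((edge_smul 1 p).trans (congrFun Sym2.map_id _))
  mul_smul g h p := edge_injective <| by
    simp only [edge_smul, Sym2.map_map]
    rfl

theorem partAut_smul (s : Perm (Fin m) × Perm (Fin n)) (p : Point m n) :
    partAut m n s • p = (s.1 p.1, s.2 p.2) :=
  edge_injective (edge_smul _ _)

theorem tau_smul (p : Point m m) : tau m • p = p.swap :=
  edge_injective ((edge_smul _ _).trans Sym2.eq_swap)

theorem edge_mem_edgeSet_iff {Δ : (Kmn m n).Subgraph} {p : Point m n} :
    edge p ∈ Δ.edgeSet ↔ p ∈ block Δ :=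
  Iff.rfl

theorem block_image (Δ : (Kmn m n).Subgraph) (g : Kmn m n ≃g Kmn m n) :
    block (image Δ g) = g • block Δ := by
  ext p
  rw [← edge_mem_edgeSet_iff, image, SimpleGraph.Subgraph.edgeSet_map]
  constructor
  · rintro ⟨e, he, hep⟩
    obtain ⟨q, rfl⟩ : e ∈ Set.range edge := range_edge ▸ Δ.edgeSet_subset he
    exact ⟨q, he, edge_injective ((edge_smul g q).trans hep)⟩
  · rintro ⟨q, hq, rfl⟩
    exact ⟨edge q, hq, (edge_smul g q).symm⟩

theorem block_ofPairs (S : Set (Point m n)) : block (ofPairs S) = S := by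
  ext p
  simp [block, ofPairs]

theorem design_eq_ofOrbit (Δ : (Kmn m n).Subgraph) :
    design Δ = ofOrbit (groupK m n) (block Δ) := by
  ext B
  simp only [design, block_image, ofOrbit, Set.mem_ofPred_eq, mem_orbit_iff, Subgroup.smul_def,
    Subtype.exists, exists_prop, eq_comm]

end Action

section Group

variable {m n : ℕ}

theorem isLeft_apply_eq_iff (g : Kmn m n ≃g Kmn m n) (u v : Fin m ⊕ Fin n) :
    (g u).isLeft = (g v).isLeft ↔ u.isLeft = v.isLeft := by
  have h := g.map_rel_iff (a := u) (b := v)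
  revert h
  cases u <;> cases v <;> cases g _ <;> cases g _ <;> simp

theorem mem_groupK_iff {g : Kmn m n ≃g Kmn m n} (v : Fin m ⊕ Fin n) :
    g ∈ groupK m n ↔ (g v).isLeft = v.isLeft := by
  constructor
  · rintro ⟨s, rfl⟩
    cases v <;> rfl
  · intro hv
    have h_left (i : Fin m) : (g (Sum.inl i)).isLeft = true := by
      have h := isLeft_apply_eq_iff g (Sum.inl i) v
      rw [hv] at h
      cases hi : (g (Sum.inl i)).isLeft <;> cases hv : v.isLeft <;> simp_all
    obtain ⟨s, hs⟩ := Perm.mem_sumCongrHom_range_of_perm_mapsTo_inl (σ := g.toEquiv) <| by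
      rintro _ ⟨i, rfl⟩
      exact (Sum.isLeft_iff.1 (h_left i)).imp fun _ ↦ Eq.symm
    exact ⟨s, RelIso.ext fun v ↦ congrArg (· v) hs⟩

variable [NeZero m]

theorem tau_notMem_groupK : tau m ∉ groupK m m := by
  simp [mem_groupK_iff (Sum.inl 0), tau]

theorem index_groupK : (groupK m m).index = 2 := by
  refine Subgroup.index_eq_two_iff_exists_notMem_and.2
    ⟨tau m, tau_notMem_groupK, fun g ↦ or_iff_not_imp_right.2 fun hg ↦ ?_⟩
  rw [mem_groupK_iff (Sum.inl 0)] at hg ⊢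
  have h_mul : (g * tau m) (Sum.inl 0) = g (Sum.inr 0) := rfl
  have h := isLeft_apply_eq_iff g (Sum.inl 0) (Sum.inr 0)
  grind

theorem groupG_eq_top : groupG m = ⊤ := by
  have hK : groupK m m ≤ groupG m := Set.subset_union_left.trans Subgroup.subset_closure
  have h_tau : tau m ∈ groupG m := Subgroup.subset_closure (by simp)
  refine (Subgroup.eq_top_iff' _).2 fun g ↦ ?_
  by_cases hg : g ∈ groupK m m
  · exact hK hg
  · have h_mul : g * tau m ∈ groupK m m := by
      simp [Subgroup.mul_mem_iff_of_index_two index_groupK, hg, tau_notMem_groupK]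
    exact (Subgroup.mul_mem_cancel_right _ h_tau).1 (hK h_mul)

theorem designHat_eq_ofOrbit (Δ : (Kmn m m).Subgraph) :
    designHat Δ = ofOrbit (Kmn m m ≃g Kmn m m) (block Δ) := by
  ext B
  simp only [designHat, block_image, ofOrbit, groupG_eq_top, Subgroup.mem_top, true_and,
    Set.mem_ofPred_eq, mem_orbit_iff, eq_comm]

theorem designHat_eq_design {Δ : (Kmn m m).Subgraph} {ρ : Kmn m m ≃g Kmn m m}
    (hρ : ρ ∉ groupK m m) (hρΔ : ρ ∈ stabilizer (Kmn m m ≃g Kmn m m) (block Δ)) :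
    designHat Δ = design Δ := by
  rw [designHat_eq_ofOrbit, design_eq_ofOrbit]
  refine IncidenceStructure.ext (Set.Subset.antisymm ?_ (orbit_subgroup_subset _ _))
  rintro _ ⟨g, rfl⟩
  by_cases hg : g ∈ groupK m m
  · exact ⟨⟨g, hg⟩, rfl⟩
  · have h_mul : g * ρ ∈ groupK m m := by
      simp [Subgroup.mul_mem_iff_of_index_two index_groupK, hg, hρ]
    exact ⟨⟨g * ρ, h_mul⟩, (mul_smul g ρ _).trans (congrArg (g • ·) hρΔ)⟩

end Group

section Lines

variable {m n : ℕ}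

/-- The row or column of the grid formed by the points whose edges contain the vertex `v`. -/
def line (v : Fin m ⊕ Fin n) : Set (Point m n) :=
  {p | v ∈ edge p}

@[simp]
theorem mem_line_inl {p : Point m n} {i : Fin m} : p ∈ line (Sum.inl i) ↔ p.1 = i := by
  simp [line, edge, eq_comm]

@[simp]
theorem mem_line_inr {p : Point m n} {j : Fin n} : p ∈ line (Sum.inr j) ↔ p.2 = j := by
  simp [line, edge, eq_comm]

theorem smul_line (g : Kmn m n ≃g Kmn m n) (v : Fin m ⊕ Fin n) : g • line v = line (g v) := by
  ext p
  obtain ⟨q, rfl⟩ := MulAction.surjective g p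
  simp [Set.smul_mem_smul_set_iff, line, edge_smul, Sym2.mem_map]

theorem eq_of_mem_line {v w : Fin m ⊕ Fin n} {p q : Point m n} (hpq : p ≠ q)
    (hpv : p ∈ line v) (hqv : q ∈ line v) (hpw : p ∈ line w) (hqw : q ∈ line w) : v = w := by
  by_contra hvw
  exact hpq (edge_injective (Sym2.eq_of_ne_mem hvw hpv hpw hqv hqw))

theorem ncard_line (v : Fin m ⊕ Fin m) : (line v).ncard = m := by
  obtain i | j := v
  · have h : line (Sum.inl i) = Set.range (Prod.mk i : Fin m → Point m m) := by
      ext ⟨a, b⟩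
      simp [eq_comm]
    rw [h, Set.ncard_range_of_injective (Prod.mk_right_injective i), Nat.card_fin]
  · have h : line (Sum.inr j) = Set.range ((·, j) : Fin m → Point m m) := by
      ext ⟨a, b⟩
      simp [eq_comm]
    rw [h, Set.ncard_range_of_injective (Prod.mk_left_injective j), Nat.card_fin]

/-- The two-element sets of points contained in a line `line v` with `v ∈ V`; thus `linePairs univ`
is the set of all collinear pairs. -/
def linePairs (V : Set (Fin m ⊕ Fin n)) : Set (Set (Point m n)) :=
  {T | T.ncard = 2 ∧ ∃ v ∈ V, T ⊆ line v}

theorem smul_mem_linePairs {V W : Set (Fin m ⊕ Fin n)} {g : Kmn m n ≃g Kmn m n}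
    (hg : Set.MapsTo g V W) {T : Set (Point m n)} (hT : T ∈ linePairs V) :
    g • T ∈ linePairs W := by
  obtain ⟨hT, v, hv, hTv⟩ := hT
  exact ⟨(Set.ncard_smul_set g T).trans hT, g v, hg hv,
    smul_line g v ▸ Set.smul_set_mono hTv⟩

theorem linePairs_union (V W : Set (Fin m ⊕ Fin n)) :
    linePairs (V ∪ W) = linePairs V ∪ linePairs W := by
  ext T
  simp only [linePairs, Set.mem_union, Set.mem_ofPred_eq]
  grind

theorem disjoint_linePairs {V W : Set (Fin m ⊕ Fin n)} (hVW : Disjoint V W) :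
    Disjoint (linePairs V) (linePairs W) := by
  refine Set.disjoint_left.2 ?_
  rintro T ⟨hT, v, hv, hTv⟩ ⟨-, w, hw, hTw⟩
  obtain ⟨p, q, hpq, rfl⟩ := Set.ncard_eq_two.1 hT
  rw [Set.pair_subset_iff] at hTv hTw
  exact hVW.ne_of_mem hv hw (eq_of_mem_line hpq hTv.1 hTv.2 hTw.1 hTw.2)

theorem ncard_linePairs_univ :
    (linePairs (Set.univ : Set (Fin m ⊕ Fin m))).ncard = 2 * m * m.choose 2 := by
  have h_union : linePairs (Set.univ : Set (Fin m ⊕ Fin m)) = ⋃ v, linePairs {v} := by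
    ext T
    simp [linePairs]
  have h_single (v : Fin m ⊕ Fin m) : (linePairs {v}).ncard = m.choose 2 := by
    have h_pow := Set.ncard_powerset_ncard (line v).toFinite 2
    rw [ncard_line] at h_pow
    rw [← h_pow]
    congr 1
    ext T
    simp [linePairs, and_comm]
  rw [h_union, Set.ncard_iUnion_of_finite (fun _ ↦ Set.toFinite _)
    fun v w hvw ↦ disjoint_linePairs (Set.disjoint_singleton.2 hvw), finsum_eq_sum_of_fintype]
  simp [h_single, two_mul]

theorem pair_mem_linePairs_univ {p q : Point m n} (hpq : p ≠ q) :
    {p, q} ∈ linePairs (Set.univ : Set (Fin m ⊕ Fin n)) ↔ p.1 = q.1 ∨ p.2 = q.2 := by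
  simp [linePairs, Set.ncard_pair hpq, Set.pair_subset_iff, eq_comm]

theorem exists_perm_apply_eq {α : Type*} {a b c d : α} (h : a = b ↔ c = d) :
    ∃ σ : Perm α, σ a = c ∧ σ b = d := by
  by_cases hab : a = b
  · obtain rfl := hab
    obtain ⟨σ, hσ⟩ := MulAction.exists_smul_eq (Perm α) a c
    exact ⟨σ, hσ, hσ.trans (h.1 rfl)⟩
  · exact is_two_pretransitive_iff.1 (Perm.isMultiplyPretransitive α 2) hab (hab ∘ h.2)

theorem pair_mem_orbit {p q p' q' : Point m n} (h₁ : p.1 = q.1 ↔ p'.1 = q'.1)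
    (h₂ : p.2 = q.2 ↔ p'.2 = q'.2) :
    {p', q'} ∈ orbit (Kmn m n ≃g Kmn m n) ({p, q} : Set (Point m n)) := by
  obtain ⟨a, hap, haq⟩ := exists_perm_apply_eq h₁
  obtain ⟨b, hbp, hbq⟩ := exists_perm_apply_eq h₂
  refine ⟨partAut m n (a, b), ?_⟩
  simp only [← Set.image_smul, Set.image_pair, partAut_smul, hap, haq, hbp, hbq]

theorem pair_mem_orbit_of_swap {p q p' q' : Point m m} (h₁ : p.1 = q.1 ↔ p'.2 = q'.2)
    (h₂ : p.2 = q.2 ↔ p'.1 = q'.1) :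
    {p', q'} ∈ orbit (Kmn m m ≃g Kmn m m) ({p, q} : Set (Point m m)) := by
  have h_tau : tau m • ({p'.swap, q'.swap} : Set (Point m m)) = {p', q'} := by
    simp only [← Set.image_smul, Set.image_pair, tau_smul, Prod.swap_swap]
  exact h_tau ▸ mem_orbit_of_mem_orbit (tau m)
    (pair_mem_orbit (p' := p'.swap) (q' := q'.swap) h₁ h₂)

theorem orbit_eq_linePairs_univ {T : Set (Point m m)} (hT : T ∈ linePairs Set.univ) :
    orbit (Kmn m m ≃g Kmn m m) T = linePairs Set.univ := by
  ext T'
  constructor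
  · rintro ⟨g, rfl⟩
    exact smul_mem_linePairs (Set.mapsTo_univ _ _) hT
  · intro hT'
    obtain ⟨p, q, hpq, rfl⟩ := Set.ncard_eq_two.1 hT.1
    obtain ⟨p', q', hpq', rfl⟩ := Set.ncard_eq_two.1 hT'.1
    rw [pair_mem_linePairs_univ hpq] at hT
    rw [pair_mem_linePairs_univ hpq'] at hT'
    rw [Ne, Prod.ext_iff] at hpq hpq'
    by_cases h : p.1 = q.1 ↔ p'.1 = q'.1
    · exact pair_mem_orbit h (by tauto)
    · exact pair_mem_orbit_of_swap (by tauto) (by tauto)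

theorem orbit_eq_diff_linePairs_univ {T : Set (Point m n)} (hT2 : T.ncard = 2)
    (hT : T ∉ linePairs Set.univ) :
    orbit (Kmn m n ≃g Kmn m n) T = {T | T.ncard = 2} \ linePairs Set.univ := by
  ext T'
  constructor
  · rintro ⟨g, rfl⟩
    refine ⟨(Set.ncard_smul_set g T).trans hT2, fun h ↦ hT ?_⟩
    simpa using smul_mem_linePairs (g := g⁻¹) (Set.mapsTo_univ _ _) h
  · rintro ⟨hT2', hT'⟩
    obtain ⟨p, q, hpq, rfl⟩ := Set.ncard_eq_two.1 hT2
    obtain ⟨p', q', hpq', rfl⟩ := Set.ncard_eq_two.1 hT2'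
    rw [pair_mem_linePairs_univ hpq] at hT
    rw [pair_mem_linePairs_univ hpq'] at hT'
    exact pair_mem_orbit (by tauto) (by tauto)

theorem ncard_linePairs_add_ncard_diff (B : Set (Point m n)) :
    {T | T ∈ linePairs Set.univ ∧ T ⊆ B}.ncard +
      {T | T ∈ {T | T.ncard = 2} \ linePairs Set.univ ∧ T ⊆ B}.ncard = B.ncard.choose 2 := by
  rw [← Set.ncard_powerset_ncard B.toFinite,
    ← Set.ncard_inter_add_ncard_sdiff_eq_ncard {T | T ⊆ B ∧ T.ncard = 2} (linePairs Set.univ)]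
  congr 1 <;> refine congrArg Set.ncard (Set.ext fun T ↦ ?_) <;>
    simp only [linePairs, Set.mem_ofPred_eq, Set.mem_inter_iff, Set.mem_sdiff] <;> tauto

theorem two_mul_choose_two_card_point :
    2 * (Nat.card (Point m m)).choose 2 =
      (m + 1) * (linePairs (Set.univ : Set (Fin m ⊕ Fin m))).ncard := by
  rw [ncard_linePairs_univ, Nat.card_prod, Nat.card_fin, ← Nat.cast_inj (R := ℚ)]
  push_cast [Nat.cast_choose_two]
  ring

theorem designHat_isTDesign_two_iff {Δ : (Kmn m m).Subgraph} (hm : 2 ≤ m)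
    (hΔ : 2 ≤ (block Δ).ncard) :
    (designHat Δ).IsTDesign 2 ↔ 2 * (block Δ).ncard.choose 2 =
      (m + 1) * {T | T ∈ linePairs Set.univ ∧ T ⊆ block Δ}.ncard := by
  have : NeZero m := ⟨by omega⟩
  rw [designHat_eq_ofOrbit, ofOrbit_isTDesign_iff two_pos hΔ]
  set L := (linePairs (Set.univ : Set (Fin m ⊕ Fin m))).ncard with hL
  set N := ({T : Set (Point m m) | T.ncard = 2} \ linePairs Set.univ).ncard
  set x := {T | T ∈ linePairs Set.univ ∧ T ⊆ block Δ}.ncard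
  have hLpos : 0 < L := by
    rw [hL, ncard_linePairs_univ]
    have := Nat.choose_pos hm
    positivity
  have h_total : L + N = (Nat.card (Point m m)).choose 2 := by
    simpa only [Set.subset_univ, and_true, Set.ofPred_mem_eq, Set.ncard_univ] using
      ncard_linePairs_add_ncard_diff (Set.univ : Set (Point m m))
  have h_block := ncard_linePairs_add_ncard_diff (block Δ)
  have h_double : 2 * (Nat.card (Point m m)).choose 2 = (m + 1) * L :=
    two_mul_choose_two_card_point
  constructor
  · intro h
    obtain ⟨T, hT⟩ := Set.nonempty_of_ncard_ne_zero hLpos.ne'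
    have hT_eq := h T hT.1
    rw [orbit_eq_linePairs_univ hT] at hT_eq
    refine Nat.eq_of_mul_eq_mul_left hLpos ?_
    linear_combination 2 * hT_eq + x * h_double
  · intro h T hT2
    have h_line : L * (block Δ).ncard.choose 2 = (Nat.card (Point m m)).choose 2 * x := by
      refine Nat.eq_of_mul_eq_mul_left two_pos ?_
      linear_combination L * h + x * h_double.symm
    by_cases hT : T ∈ linePairs Set.univ
    · rwa [orbit_eq_linePairs_univ hT]
    · rw [orbit_eq_diff_linePairs_univ hT2 hT]
      refine Nat.add_left_cancel (n := L * (block Δ).ncard.choose 2) ?_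
      linear_combination (block Δ).ncard.choose 2 * h_total +
        (Nat.card (Point m m)).choose 2 * h_block.symm + h_line.symm

theorem ncard_linePairs_left_eq_right :
    (linePairs {v : Fin m ⊕ Fin m | v.isLeft = true}).ncard =
      (linePairs {v : Fin m ⊕ Fin m | v.isLeft = false}).ncard := by
  have h_maps (c : Bool) : Set.MapsTo (tau m) {v | v.isLeft = c} {v | v.isLeft = !c} := by
    rintro (i | i) rfl <;> rfl
  have h_le (c : Bool) : (linePairs {v : Fin m ⊕ Fin m | v.isLeft = c}).ncard ≤
      (linePairs {v : Fin m ⊕ Fin m | v.isLeft = !c}).ncard := by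
    rw [← Set.ncard_smul_set (tau m)]
    refine Set.ncard_le_ncard ?_
    rintro _ ⟨T, hT, rfl⟩
    exact smul_mem_linePairs (h_maps c) hT
  exact (h_le true).antisymm (h_le false)

theorem even_ncard_linePairs_of_isTDesign_two {Δ : (Kmn m m).Subgraph}
    (hΔ : (design Δ).IsTDesign 2) :
    Even {T | T ∈ linePairs Set.univ ∧ T ⊆ block Δ}.ncard := by
  rw [design_eq_ofOrbit] at hΔ
  obtain ⟨_, _, l, hD⟩ := hΔ
  have h_count (c : Bool) :=
    hD.ncard_invariant_mul_eq (𝒯 := linePairs {v : Fin m ⊕ Fin m | v.isLeft = c})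
      (fun g T hT ↦ smul_mem_linePairs (fun v hv ↦ ((mem_groupK_iff v).1 g.2).trans hv) hT)
      fun T hT ↦ hT.1
  have h_eq := Nat.eq_of_mul_eq_mul_left ncard_orbit_pos
    ((h_count true).symm.trans ((congrArg (· * l) ncard_linePairs_left_eq_right).trans
      (h_count false)))
  have h_univ : (Set.univ : Set (Fin m ⊕ Fin m)) =
      {v | v.isLeft = true} ∪ {v | v.isLeft = false} := by
    ext v
    cases v <;> simp
  have h_disj : Disjoint {v : Fin m ⊕ Fin m | v.isLeft = true} {v | v.isLeft = false} :=
    Set.disjoint_left.2 fun v hv hv' ↦ Bool.noConfusion (hv.symm.trans hv')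
  refine ⟨{T | T ∈ linePairs {v | v.isLeft = true} ∧ T ⊆ block Δ}.ncard, ?_⟩
  conv_rhs => arg 2; rw [h_eq]
  rw [h_univ, linePairs_union, ← Set.ncard_union_eq]
  · congr 1
    ext T
    simp only [Set.mem_union, Set.mem_ofPred_eq, or_and_right]
  · exact (disjoint_linePairs h_disj).mono (fun _ h ↦ h.1) fun _ h ↦ h.1

theorem exists_le_ncard_inter_line {Δ : (Kmn m m).Subgraph} [NeZero m] {t : ℕ} (ht : t ≤ m)
    (hΔ : (designHat Δ).IsTDesign t) : ∃ v, t ≤ (block Δ ∩ line v).ncard := by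
  obtain ⟨_, _, _, hD⟩ := hΔ
  obtain ⟨T, hT_line, hT⟩ := Set.exists_subset_card_eq (ht.trans_eq (ncard_line (Sum.inl 0)).symm)
  obtain ⟨B, hB, hTB⟩ := hD.exists_block_superset hT
  rw [designHat_eq_ofOrbit] at hB
  obtain ⟨g, rfl⟩ := hB
  refine ⟨g⁻¹ (Sum.inl 0), hT.symm.trans_le ?_⟩
  rw [← Set.ncard_smul_set g (block Δ ∩ _), Set.smul_set_inter, smul_line, RelIso.apply_inv_self]
  exact Set.ncard_le_ncard (Set.subset_inter hTB hT_line)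

end Lines

section Path

variable {m k : ℕ} [NeZero m]

/-- The `n`-th vertex of the infinite walk `R₁, C₁, R₂, C₂, …`, whose first `k + 1` vertices are
those of `path m k`. Indices are reduced modulo `m`; no reduction occurs along a path that fits
into `K_{m,m}`. -/
def pathVertex (m : ℕ) [NeZero m] (n : ℕ) : Fin m ⊕ Fin m :=
  if Even n then Sum.inl (Fin.ofNat m (n / 2)) else Sum.inr (Fin.ofNat m (n / 2))

/-- The point whose edge is the `n`-th edge of the walk `pathVertex m`. -/
def pathPoint (m : ℕ) [NeZero m] (n : ℕ) : Point m m :=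
  (Fin.ofNat m ((n + 1) / 2), Fin.ofNat m (n / 2))

theorem edge_pathPoint (n : ℕ) :
    edge (pathPoint m n) = s(pathVertex m n, pathVertex m (n + 1)) := by
  obtain ⟨j, rfl | rfl⟩ := n.even_or_odd'
  · simp [edge, pathPoint, pathVertex, show (2 * j + 1) / 2 = j by omega]
  · simp [edge, pathPoint, pathVertex, Nat.even_add_one, show (2 * j + 1) / 2 = j by omega,
      show (2 * j + 1 + 1) / 2 = j + 1 by omega, Sym2.eq_swap]

theorem ofNat_inj {a b : ℕ} (ha : a < m) (hb : b < m) :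
    Fin.ofNat m a = Fin.ofNat m b ↔ a = b := by
  rw [Fin.ext_iff, Fin.val_ofNat, Fin.val_ofNat, Nat.mod_eq_of_lt ha, Nat.mod_eq_of_lt hb]

theorem injOn_pathVertex (hm : k / 2 + 1 ≤ m) : (Set.Iic k).InjOn (pathVertex m) := by
  intro a (ha : a ≤ k) b (hb : b ≤ k) hab
  have h := ofNat_inj (m := m) (a := a / 2) (b := b / 2) (by omega) (by omega)
  grind [pathVertex]

theorem pathPoint_eq_iff (hm : k / 2 + 1 ≤ m) {n : ℕ} (hn : n < k) {p : Point m m} :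
    pathPoint m n = p ↔ (n + 1) / 2 = p.1 ∧ n / 2 = p.2 := by
  rw [Prod.ext_iff, Fin.ext_iff, Fin.ext_iff, pathPoint, Fin.val_ofNat, Fin.val_ofNat,
    Nat.mod_eq_of_lt (by omega), Nat.mod_eq_of_lt (by omega)]

theorem block_path (hm : k / 2 + 1 ≤ m) : block (path m k) = pathPoint m '' Set.Iio k := by
  rw [path, block_ofPairs]
  ext p
  constructor
  · intro hp
    have h_lt : (p.1 + p.2 : ℕ) < k := by
      rw [Set.mem_ofPred_eq] at hp
      omega
    refine ⟨p.1 + p.2, h_lt, (pathPoint_eq_iff hm h_lt).2 ?_⟩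
    rw [Set.mem_ofPred_eq] at hp
    omega
  · rintro ⟨n, hn, h⟩
    have h_coord := (pathPoint_eq_iff hm hn).1 h
    rw [Set.mem_Iio] at hn
    rw [Set.mem_ofPred_eq]
    omega

theorem mem_line_pathPoint {n : ℕ} {v : Fin m ⊕ Fin m} :
    pathPoint m n ∈ line v ↔ v = pathVertex m n ∨ v = pathVertex m (n + 1) := by
  rw [line, Set.mem_ofPred_eq, edge_pathPoint, Sym2.mem_iff]

theorem injOn_pathPoint (hm : k / 2 + 1 ≤ m) : (Set.Iio k).InjOn (pathPoint m) := by
  intro a (ha : a < k) b (hb : b < k) hab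
  have h_edge := congrArg edge hab
  have h_inj := injOn_pathVertex hm
  rw [edge_pathPoint, edge_pathPoint, Sym2.eq_iff] at h_edge
  rcases h_edge with ⟨h, -⟩ | ⟨h, h'⟩
  · exact h_inj ha.le hb.le h
  · have := h_inj (by grind) (by grind) h
    have := h_inj (by grind) (by grind) h'
    omega

theorem ncard_block_path (hm : k / 2 + 1 ≤ m) : (block (path m k)).ncard = k := by
  rw [block_path hm, (injOn_pathPoint hm).ncard_image]
  simp

theorem succ_eq_or_eq_succ_of_mem_line (hm : k / 2 + 1 ≤ m) {i j : ℕ} (hi : i < k) (hj : j < k)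
    (hij : i ≠ j) {v : Fin m ⊕ Fin m} (hiv : pathPoint m i ∈ line v)
    (hjv : pathPoint m j ∈ line v) : i + 1 = j ∨ j + 1 = i := by
  have h_inj {a b : ℕ} (ha : a ≤ k) (hb : b ≤ k) (h : pathVertex m a = pathVertex m b) : a = b :=
    injOn_pathVertex hm ha hb h
  rw [mem_line_pathPoint] at hiv hjv
  grind

theorem ncard_block_path_inter_line_le (hm : k / 2 + 1 ≤ m) (v : Fin m ⊕ Fin m) :
    (block (path m k) ∩ line v).ncard ≤ 2 := by
  by_contra! h
  rw [Set.two_lt_ncard_iff, block_path hm] at h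
  obtain ⟨_, _, _, ⟨⟨a, ha, rfl⟩, hav⟩, ⟨⟨b, hb, rfl⟩, hbv⟩, ⟨⟨c, hc, rfl⟩, hcv⟩, hab, hac, hbc⟩ :=
    h
  have := succ_eq_or_eq_succ_of_mem_line hm ha hb (ne_of_apply_ne _ hab) hav hbv
  have := succ_eq_or_eq_succ_of_mem_line hm ha hc (ne_of_apply_ne _ hac) hav hcv
  have := succ_eq_or_eq_succ_of_mem_line hm hb hc (ne_of_apply_ne _ hbc) hbv hcv
  omega

theorem pair_pathPoint_mem_linePairs (hm : k / 2 + 1 ≤ m) {n : ℕ} (hn : n + 1 < k) :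
    {pathPoint m n, pathPoint m (n + 1)} ∈ linePairs (Set.univ : Set (Fin m ⊕ Fin m)) := by
  have h_ne : pathPoint m n ≠ pathPoint m (n + 1) := fun h ↦
    n.succ_ne_self (injOn_pathPoint hm (Nat.lt_of_succ_lt hn) hn h).symm
  refine ⟨Set.ncard_pair h_ne, pathVertex m (n + 1), trivial, Set.pair_subset ?_ ?_⟩
  · exact mem_line_pathPoint.2 (Or.inr rfl)
  · exact mem_line_pathPoint.2 (Or.inl rfl)

theorem linePairs_block_path (hm : k / 2 + 1 ≤ m) :
    {T | T ∈ linePairs Set.univ ∧ T ⊆ block (path m k)} =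
      (fun n ↦ {pathPoint m n, pathPoint m (n + 1)}) '' Set.Iio (k - 1) := by
  rw [block_path hm]
  ext T
  constructor
  · rintro ⟨⟨hT, v, -, hTv⟩, hTB⟩
    obtain ⟨p, q, hpq, rfl⟩ := Set.ncard_eq_two.1 hT
    rw [Set.pair_subset_iff] at hTv hTB
    obtain ⟨⟨i, hi, rfl⟩, j, hj, rfl⟩ := hTB
    rw [Set.mem_Iio] at hi hj
    obtain rfl | rfl :=
      succ_eq_or_eq_succ_of_mem_line hm hi hj (ne_of_apply_ne _ hpq) hTv.1 hTv.2
    · exact ⟨i, Nat.lt_sub_of_add_lt hj, rfl⟩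
    · exact ⟨j, Nat.lt_sub_of_add_lt hi, Set.pair_comm _ _⟩
  · rintro ⟨n, hn, rfl⟩
    have hn' : n + 1 < k := Nat.add_lt_of_lt_sub hn
    exact ⟨pair_pathPoint_mem_linePairs hm hn', Set.pair_subset
      (Set.mem_image_of_mem _ (Nat.lt_of_succ_lt hn')) (Set.mem_image_of_mem _ hn')⟩

theorem ncard_linePairs_block_path (hm : k / 2 + 1 ≤ m) :
    {T | T ∈ linePairs Set.univ ∧ T ⊆ block (path m k)}.ncard = k - 1 := by
  rw [linePairs_block_path hm, Set.InjOn.ncard_image, ← Finset.coe_Iio, Set.ncard_coe_finset,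
    Nat.card_Iio]
  intro a ha b hb hab
  have h_inj {i j : ℕ} (hi : i < k) (hj : j < k) (h : pathPoint m i = pathPoint m j) : i = j :=
    injOn_pathPoint hm hi hj h
  simp only [Set.mem_Iio] at ha hb
  rcases Set.pair_eq_pair_iff.1 hab with ⟨h, -⟩ | ⟨h, h'⟩
  · exact h_inj (by omega) (by omega) h
  · have := h_inj (by omega) (by omega) h
    have := h_inj (by omega) (by omega) h'
    omega

theorem eq_add_or_add_eq_of_injOn {f : ℕ → ℕ} (hf : (Set.Iic k).InjOn f)
    (h_step : ∀ n < k, f (n + 1) = f n + 1 ∨ f (n + 1) + 1 = f n) :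
    (∀ n ≤ k, f n = f 0 + n) ∨ ∀ n ≤ k, f n + n = f 0 := by
  induction k with
  | zero => simp
  | succ k ih =>
    have h_init := ih (hf.mono (Set.Iic_subset_Iic.2 k.le_succ)) fun n hn ↦
      h_step n (hn.trans k.lt_succ_self)
    have h_last := h_step k k.lt_succ_self
    obtain _ | j := k
    · grind
    have h_turn : f (j + 1 + 1) ≠ f j := fun h ↦ by
      have := hf (Set.mem_Iic.2 le_rfl) (Set.mem_Iic.2 (by omega)) h
      omega
    refine h_init.imp (fun h n hn ↦ ?_) fun h n hn ↦ ?_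
    all_goals
      have h_fj := h j j.le_succ
      have h_fj' := h (j + 1) le_rfl
      obtain hn | rfl : n ≤ j + 1 ∨ n = j + 1 + 1 := by omega
      · exact h n hn
      · omega

theorem smul_pathPoint_eq_iff {g : Kmn m m ≃g Kmn m m} {i j : ℕ} :
    g • pathPoint m i = pathPoint m j ↔
      s(g (pathVertex m i), g (pathVertex m (i + 1))) =
        s(pathVertex m j, pathVertex m (j + 1)) := by
  rw [← edge_injective.eq_iff, edge_smul, edge_pathPoint, edge_pathPoint, Sym2.map_mk]

theorem mem_stabilizer_block_path (hm : k / 2 + 1 ≤ m) {g : Kmn m m ≃g Kmn m m}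
    (hg : ∀ i < k, ∃ j < k, g • pathPoint m i = pathPoint m j) :
    g ∈ stabilizer (Kmn m m ≃g Kmn m m) (block (path m k)) := by
  rw [mem_stabilizer_set_iff_smul_set_subset (Set.toFinite _), block_path hm]
  rintro _ ⟨_, ⟨i, hi, rfl⟩, rfl⟩
  obtain ⟨j, hj, hij⟩ := hg i hi
  exact ⟨j, hj, hij.symm⟩

theorem exists_edge_eq_of_mem_stabilizer (hm : k / 2 + 1 ≤ m) {g : Kmn m m ≃g Kmn m m}
    (hg : g ∈ stabilizer (Kmn m m ≃g Kmn m m) (block (path m k))) {i : ℕ} (hi : i < k) :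
    ∃ j < k, s(g (pathVertex m i), g (pathVertex m (i + 1))) =
      s(pathVertex m j, pathVertex m (j + 1)) := by
  have h_mem : pathPoint m i ∈ block (path m k) := block_path hm ▸ Set.mem_image_of_mem _ hi
  have h_smul := Set.smul_mem_smul_set (a := g) h_mem
  rw [mem_stabilizer_iff.1 hg, block_path hm] at h_smul
  obtain ⟨j, hj, h⟩ := h_smul
  exact ⟨j, hj, smul_pathPoint_eq_iff.1 h.symm⟩

theorem fixes_or_reverses_of_mem_stabilizer (hk : 0 < k) (hm : k / 2 + 1 ≤ m)
    {g : Kmn m m ≃g Kmn m m} (hg : g ∈ stabilizer (Kmn m m ≃g Kmn m m) (block (path m k))) :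
    (∀ n ≤ k, g (pathVertex m n) = pathVertex m n) ∨
      ∀ n ≤ k, g (pathVertex m n) = pathVertex m (k - n) := by
  have h_vertex (n : ℕ) (hn : n ≤ k) : ∃ i ≤ k, g (pathVertex m n) = pathVertex m i := by
    obtain ⟨a, ha, hna⟩ : ∃ a < k, n = a ∨ n = a + 1 := by
      obtain hn | rfl := hn.lt_or_eq
      · exact ⟨n, hn, Or.inl rfl⟩
      · exact ⟨n - 1, Nat.sub_lt hk one_pos, Or.inr (Nat.sub_add_cancel hk).symm⟩
    obtain ⟨j, hj, h⟩ := exists_edge_eq_of_mem_stabilizer hm hg ha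
    grind [Sym2.eq_iff]
  choose! f hf_le hf using h_vertex
  have h_inj {a b : ℕ} (ha : a ≤ k) (hb : b ≤ k) (h : pathVertex m a = pathVertex m b) : a = b :=
    injOn_pathVertex hm ha hb h
  have hf_inj : (Set.Iic k).InjOn f := fun a ha b hb hab ↦
    h_inj ha hb (g.injective (by rw [hf a ha, hf b hb, hab]))
  have h_step (n : ℕ) (hn : n < k) : f (n + 1) = f n + 1 ∨ f (n + 1) + 1 = f n := by
    obtain ⟨j, hj, h⟩ := exists_edge_eq_of_mem_stabilizer hm hg hn
    rw [hf n hn.le, hf (n + 1) hn, Sym2.eq_iff] at h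
    grind
  have hf_last := hf_le k le_rfl
  have hf_zero := hf_le 0 k.zero_le
  refine (eq_add_or_add_eq_of_injOn hf_inj h_step).imp (fun h n hn ↦ ?_) fun h n hn ↦ ?_
  all_goals
    have h_last := h k le_rfl
    have h_n := h n hn
    rw [hf n hn]
    congr 1
    omega

theorem exists_perm_ofNat_eq_rev {r : ℕ} (hr : r ≤ m) :
    ∃ σ : Perm (Fin m), ∀ i < r, σ (Fin.ofNat m i) = Fin.ofNat m (r - 1 - i) := by
  have := Perm.isMultiplyPretransitive (Fin m) r
  obtain ⟨σ, hσ⟩ := MulAction.exists_smul_eq (Perm (Fin m)) (Fin.castLEEmb hr)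
    (Fin.revPerm.toEmbedding.trans (Fin.castLEEmb hr))
  refine ⟨σ, fun i hi ↦ ?_⟩
  have h := DFunLike.congr_fun hσ ⟨i, hi⟩
  have h_ofNat (j : ℕ) (hj : j < r) : Fin.ofNat m j = Fin.castLEEmb hr ⟨j, hj⟩ :=
    Fin.ext (Nat.mod_eq_of_lt (hj.trans_le hr))
  rw [h_ofNat i hi, h_ofNat (r - 1 - i) (by omega)]
  refine h.trans (Fin.ext ?_)
  simp
  omega

theorem pathVertex_two_mul (i : ℕ) : pathVertex m (2 * i) = Sum.inl (Fin.ofNat m i) := by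
  simp [pathVertex]

theorem pathVertex_two_mul_add_one (i : ℕ) :
    pathVertex m (2 * i + 1) = Sum.inr (Fin.ofNat m i) := by
  simp [pathVertex, show (2 * i + 1) / 2 = i by omega]

theorem exists_reverses_pathVertex (hm : k / 2 + 1 ≤ m) :
    ∃ ρ : Kmn m m ≃g Kmn m m, ∀ n ≤ k, ρ (pathVertex m n) = pathVertex m (k - n) := by
  obtain ⟨h, rfl | rfl⟩ := k.even_or_odd'
  · obtain ⟨σ, hσ⟩ := exists_perm_ofNat_eq_rev (m := m) (r := h + 1) (by omega)
    obtain ⟨σ', hσ'⟩ := exists_perm_ofNat_eq_rev (m := m) (r := h) (by omega)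
    refine ⟨partAut m m (σ, σ'), fun n hn ↦ ?_⟩
    obtain ⟨i, rfl | rfl⟩ := n.even_or_odd'
    · rw [show 2 * h - 2 * i = 2 * (h + 1 - 1 - i) by omega, pathVertex_two_mul,
        pathVertex_two_mul, ← hσ i (by omega)]
      rfl
    · rw [show 2 * h - (2 * i + 1) = 2 * (h - 1 - i) + 1 by omega, pathVertex_two_mul_add_one,
        pathVertex_two_mul_add_one, ← hσ' i (by omega)]
      rfl
  · obtain ⟨σ, hσ⟩ := exists_perm_ofNat_eq_rev (m := m) (r := h + 1) (by omega)
    refine ⟨partAut m m (σ, σ) * tau m, fun n hn ↦ ?_⟩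
    obtain ⟨i, rfl | rfl⟩ := n.even_or_odd'
    · rw [show 2 * h + 1 - 2 * i = 2 * (h + 1 - 1 - i) + 1 by omega, pathVertex_two_mul,
        pathVertex_two_mul_add_one, ← hσ i (by omega)]
      rfl
    · rw [show 2 * h + 1 - (2 * i + 1) = 2 * (h + 1 - 1 - i) by omega, pathVertex_two_mul,
        pathVertex_two_mul_add_one, ← hσ i (by omega)]
      rfl

/-- The pointwise stabilizer, in the full automorphism group of `K_{m,m}`, of the vertices of
`path m k`. -/
def pathFixer (m k : ℕ) [NeZero m] : Subgroup (Kmn m m ≃g Kmn m m) :=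
  fixingSubgroup (Kmn m m ≃g Kmn m m) (pathVertex m '' Set.Iic k)

theorem mem_pathFixer_iff {g : Kmn m m ≃g Kmn m m} :
    g ∈ pathFixer m k ↔ ∀ n ≤ k, g (pathVertex m n) = pathVertex m n := by
  simp [pathFixer, mem_fixingSubgroup_iff, RelIso.smul_def]

theorem pathFixer_le_groupK : pathFixer m k ≤ groupK m m := fun g hg ↦
  (mem_groupK_iff (pathVertex m 0)).2 (by rw [mem_pathFixer_iff.1 hg 0 k.zero_le])

theorem pathFixer_le_stabilizer (hm : k / 2 + 1 ≤ m) :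
    pathFixer m k ≤ stabilizer (Kmn m m ≃g Kmn m m) (block (path m k)) := fun g hg ↦
  mem_stabilizer_block_path hm fun n hn ↦ ⟨n, hn, smul_pathPoint_eq_iff.2 <| by
    rw [mem_pathFixer_iff.1 hg n hn.le, mem_pathFixer_iff.1 hg (n + 1) hn]⟩

theorem mem_stabilizer_of_reverses (hm : k / 2 + 1 ≤ m) {ρ : Kmn m m ≃g Kmn m m}
    (hρ : ∀ n ≤ k, ρ (pathVertex m n) = pathVertex m (k - n)) :
    ρ ∈ stabilizer (Kmn m m ≃g Kmn m m) (block (path m k)) :=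
  mem_stabilizer_block_path hm fun n hn ↦ ⟨k - 1 - n, by omega, smul_pathPoint_eq_iff.2 <| by
    rw [hρ n hn.le, hρ (n + 1) hn, Sym2.eq_swap, show k - 1 - n + 1 = k - n by omega,
      show k - (n + 1) = k - 1 - n by omega]⟩

theorem relIndex_pathFixer_stabilizer (hk : 0 < k) (hm : k / 2 + 1 ≤ m) :
    (pathFixer m k).relIndex (stabilizer (Kmn m m ≃g Kmn m m) (block (path m k))) = 2 := by
  obtain ⟨ρ, hρ⟩ := exists_reverses_pathVertex hm
  refine Subgroup.relIndex_eq_two_iff_exists_notMem_and.2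
    ⟨ρ, mem_stabilizer_of_reverses hm hρ, fun h ↦ hk.ne ?_, fun g hg ↦ ?_⟩
  · refine injOn_pathVertex hm k.zero_le (Set.mem_Iic.2 le_rfl) ?_
    rw [← mem_pathFixer_iff.1 h 0 k.zero_le, hρ 0 k.zero_le, Nat.sub_zero]
  · simp only [mem_pathFixer_iff]
    refine (fixes_or_reverses_of_mem_stabilizer hk hm hg).symm.imp_left fun h n hn ↦ ?_
    rw [RelIso.mul_apply, hρ n hn, h _ (k.sub_le n), Nat.sub_sub_self hn]

theorem ncard_orbit_block_path (hk : 0 < k) (hm : k / 2 + 1 ≤ m) :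
    (orbit (Kmn m m ≃g Kmn m m) (block (path m k))).ncard =
      (pathFixer m k).relIndex (groupK m m) := by
  refine Nat.eq_of_mul_eq_mul_left two_pos ?_
  calc 2 * (orbit (Kmn m m ≃g Kmn m m) (block (path m k))).ncard
    _ = (pathFixer m k).index := by
      rw [← index_stabilizer, ← Subgroup.relIndex_mul_index (pathFixer_le_stabilizer hm),
        relIndex_pathFixer_stabilizer hk hm]
    _ = 2 * (pathFixer m k).relIndex (groupK m m) := by
      rw [← Subgroup.relIndex_mul_index pathFixer_le_groupK, index_groupK, mul_comm]

theorem index_fixingSubgroup_ofNat_mul {r : ℕ} (hr : r ≤ m) :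
    (fixingSubgroup (Perm (Fin m)) (Fin.ofNat m '' Set.Iio r)).index * (m - r).factorial =
      m.factorial := by
  have h_ncard : (Fin.ofNat m '' Set.Iio r).ncard = r := by
    rw [Set.InjOn.ncard_image, ← Finset.coe_Iio, Set.ncard_coe_finset, Nat.card_Iio]
    exact fun a ha b hb h ↦ (ofNat_inj (ha.trans_le hr) (hb.trans_le hr)).1 h
  simpa using (Perm.isMultiplyPretransitive (Fin m) r).index_of_fixingSubgroup_mul h_ncard

theorem comap_partAut_pathFixer :
    (pathFixer m k).comap (partAut m m) =
      (fixingSubgroup (Perm (Fin m)) (Fin.ofNat m '' Set.Iio (k / 2 + 1))).prod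
        (fixingSubgroup (Perm (Fin m)) (Fin.ofNat m '' Set.Iio ((k + 1) / 2))) := by
  have h_inl (s : Perm (Fin m) × Perm (Fin m)) (i : Fin m) :
      partAut m m s (Sum.inl i) = Sum.inl (s.1 i) := rfl
  have h_inr (s : Perm (Fin m) × Perm (Fin m)) (i : Fin m) :
      partAut m m s (Sum.inr i) = Sum.inr (s.2 i) := rfl
  ext s
  simp only [Subgroup.mem_comap, mem_pathFixer_iff, Subgroup.mem_prod, mem_fixingSubgroup_iff,
    Set.forall_mem_image, Set.mem_Iio, Perm.smul_def]
  constructor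
  · refine fun h ↦ ⟨fun i hi ↦ ?_, fun i hi ↦ ?_⟩
    · simpa [pathVertex_two_mul, h_inl] using h (2 * i) (by omega)
    · simpa [pathVertex_two_mul_add_one, h_inr] using h (2 * i + 1) (by omega)
  · rintro ⟨h_left, h_right⟩ n hn
    obtain ⟨i, rfl | rfl⟩ := n.even_or_odd'
    · rw [pathVertex_two_mul, h_inl, h_left (by omega)]
    · rw [pathVertex_two_mul_add_one, h_inr, h_right (by omega)]

theorem ncard_blocks_designHat_path_mul (hk : 0 < k) (hm : k / 2 + 1 ≤ m) :
    (designHat (path m k)).blocks.ncard *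
      ((m - (k / 2 + 1)).factorial * (m - (k + 1) / 2).factorial) =
        m.factorial * m.factorial := by
  rw [designHat_eq_ofOrbit, ofOrbit, ncard_orbit_block_path hk hm, groupK,
    ← Subgroup.index_comap, comap_partAut_pathFixer, Subgroup.index_prod, mul_mul_mul_comm,
    index_fixingSubgroup_ofNat_mul hm, index_fixingSubgroup_ofNat_mul (by omega)]

theorem designHat_path_eq_design_path (hk : Odd k) (hm : k / 2 + 1 ≤ m) :
    designHat (path m k) = design (path m k) := by
  obtain ⟨ρ, hρ⟩ := exists_reverses_pathVertex hm
  have hρ_notMem : ρ ∉ groupK m m := by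
    rw [mem_groupK_iff (pathVertex m 0), hρ 0 k.zero_le]
    simp [pathVertex, Nat.not_even_iff_odd.2 hk]
  exact designHat_eq_design hρ_notMem (mem_stabilizer_of_reverses hm hρ)

theorem not_isTDesign_two_design_path (hk : Even k) (hk0 : 0 < k) (hm : k / 2 + 1 ≤ m) :
    ¬ (design (path m k)).IsTDesign 2 := fun h ↦ by
  have h_even := even_ncard_linePairs_of_isTDesign_two h
  rw [ncard_linePairs_block_path hm] at h_even
  grind

theorem not_isTDesign_three_designHat_path (hm3 : 3 ≤ m) (hm : k / 2 + 1 ≤ m) :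
    ¬ (designHat (path m k)).IsTDesign 3 := fun h ↦ by
  obtain ⟨v, hv⟩ := exists_le_ncard_inter_line hm3 h
  exact absurd (hv.trans (ncard_block_path_inter_line_le hm v)) (by norm_num)

theorem designHat_path_isTDesign_two_iff (hk : 2 ≤ k) (hm : k / 2 + 1 ≤ m) :
    (designHat (path m k)).IsTDesign 2 ↔ m = k - 1 := by
  have h_block := ncard_block_path hm
  rw [designHat_isTDesign_two_iff (by omega) (hk.trans_eq h_block.symm), h_block,
    ncard_linePairs_block_path hm, Nat.choose_two_right,
    Nat.two_mul_div_two_of_even k.even_mul_pred_self, Nat.mul_left_inj (by omega)]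
  omega

theorem cast_eq_of_isDesign_two_designHat_path (hk : 3 ≤ k) (hmk : m = k - 1) {a b l : ℕ}
    (ha : k / 2 + 1 + a = m) (hb : (k + 1) / 2 + b = m)
    (hD : (designHat (path m k)).IsDesign 2 ((k - 1) ^ 2) k l) :
    (l : ℚ) = (k - 1).factorial * (k - 3).factorial / (a.factorial * b.factorial) := by
  have h_blocks := ncard_blocks_designHat_path_mul (m := m) (k := k) (by omega) (by omega)
  have h_count := hD.choose_mul_eq
  rw [show m - (k / 2 + 1) = a by omega, show m - (k + 1) / 2 = b by omega] at h_blocks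
  obtain ⟨j, rfl⟩ := Nat.exists_eq_add_of_le' hk
  obtain rfl : m = j + 2 := hmk
  set n := (designHat (path (j + 2) (j + 3))).blocks.ncard
  have h_lambda : ((j + 2) * (j + 1) : ℚ) * l = n := by
    have h_cast := congrArg (Nat.cast : ℕ → ℚ) h_count
    push_cast [Nat.cast_choose_two, Nat.add_sub_cancel] at h_cast
    have h_pos : ((j + 3) * (j + 2) : ℚ) ≠ 0 := by positivity
    refine mul_left_cancel₀ h_pos ?_
    linear_combination 2 * h_cast
  have h_factorial : ((j + 2).factorial : ℚ) = (j + 2) * (j + 1) * j.factorial := by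
    push_cast [Nat.factorial_succ]
    ring
  have h_blocks' : (n * (a.factorial * b.factorial) : ℚ) =
      (j + 2).factorial * (j + 2).factorial := mod_cast h_blocks
  have h_pos : ((j + 2) * (j + 1) : ℚ) ≠ 0 := by positivity
  rw [eq_div_iff (by positivity)]
  refine mul_left_cancel₀ h_pos ?_
  calc ((j + 2) * (j + 1) : ℚ) * (l * (a.factorial * b.factorial))
    _ = n * (a.factorial * b.factorial) := by rw [← h_lambda]; ring
    _ = (j + 2).factorial * ((j + 2) * (j + 1) * j.factorial) := by rw [h_blocks', ← h_factorial]
    _ = (j + 2) * (j + 1) * ((j + 2).factorial * j.factorial) := by ring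

theorem exists_isDesign_two_designHat_path (hk : 3 ≤ k) (hmk : m = k - 1) {a b : ℕ}
    (ha : k / 2 + 1 + a = m) (hb : (k + 1) / 2 + b = m) :
    ∃ l : ℕ, (l : ℚ) = (k - 1).factorial * (k - 3).factorial / (a.factorial * b.factorial) ∧
      (designHat (path m k)).IsDesign 2 ((k - 1) ^ 2) k l := by
  have hm : k / 2 + 1 ≤ m := by omega
  have h_block : block (path m k) ∈ (designHat (path m k)).blocks :=
    designHat_eq_ofOrbit (path m k) ▸ mem_orbit_self (block (path m k))
  obtain ⟨l, hl⟩ := ((designHat_path_isTDesign_two_iff (by omega) hm).2 hmk).exists_isDesign h_block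
  rw [ncard_block_path hm, Nat.card_prod, Nat.card_fin, ← sq, congrArg (· ^ 2) hmk] at hl
  exact ⟨l, cast_eq_of_isDesign_two_designHat_path hk hmk ha hb hl, hl⟩

end Path

end GridDesign

theorem lemma4p2 (m k : ℕ) (hk : 3 ≤ k) (hm : k / 2 + 1 ≤ m) :
    (¬ (k = 3 ∧ m = 2) →
      ¬ (GridDesign.designHat (GridDesign.path m k)).IsTDesign 3) ∧
    ((GridDesign.designHat (GridDesign.path m k)).IsTDesign 2 ↔ m = k - 1) ∧
    (m = k - 1 →
      (Odd k →
        (GridDesign.designHat (GridDesign.path m k) = GridDesign.design (GridDesign.path m k) ∧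
          (GridDesign.design (GridDesign.path m k)).IsTDesign 2) ∧
        ∃ l : ℕ, (l : ℚ) = ((k - 1).factorial * (k - 3).factorial : ℚ) /
            (((k - 3) / 2).factorial : ℚ) ^ 2 ∧
          (GridDesign.designHat (GridDesign.path m k)).IsDesign 2 ((k - 1) ^ 2) k l) ∧
      (Even k →
        (GridDesign.designHat (GridDesign.path m k) ≠ GridDesign.design (GridDesign.path m k) ∧
          ¬ (GridDesign.design (GridDesign.path m k)).IsTDesign 2) ∧
        ∃ l : ℕ, (l : ℚ) = ((k - 1).factorial * (k - 3).factorial : ℚ) /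
            (((k / 2 - 2).factorial * (k / 2 - 1).factorial : ℕ) : ℚ) ∧
          (GridDesign.designHat (GridDesign.path m k)).IsDesign 2 ((k - 1) ^ 2) k l)) := by
  have : NeZero m := ⟨by omega⟩
  have h_two := GridDesign.designHat_path_isTDesign_two_iff (m := m) (k := k) (by omega) hm
  refine ⟨fun h ↦ GridDesign.not_isTDesign_three_designHat_path (by omega) hm, h_two, fun hmk ↦
    ⟨fun h_odd ↦ ?_, fun h_even ↦ ?_⟩⟩
  · have h_eq := GridDesign.designHat_path_eq_design_path h_odd hm
    refine ⟨⟨h_eq, h_eq ▸ h_two.2 hmk⟩, ?_⟩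
    rw [sq]
    exact GridDesign.exists_isDesign_two_designHat_path hk hmk (by grind) (by grind)
  · have h_not := GridDesign.not_isTDesign_two_design_path h_even (by omega) hm
    refine ⟨⟨fun h_eq ↦ h_not (h_eq ▸ h_two.2 hmk), h_not⟩, ?_⟩
    rw [Nat.cast_mul]
    exact GridDesign.exists_isDesign_two_designHat_path hk hmk (by grind) (by grind)
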